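/- A multiplicative Lie algebra is a group $K$ (not necessarily abelian) with a binary operation $\star$ such that, writing ${}^xy=xyx^{-1}$, for all $x,y,z\in K$: $x\star x=1$; $x\star(yz)=(x\star y)\,{}^y(x\star z)$; $(xy)\star z={}^x(y\star z)\,(x\star z)$; $((x\star y)\star{}^yz)((y\star z)\star{}^zx)((z\star x)\star{}^xy)=1$; ${}^z(x\star y)={}^zx\star{}^zy$. It is trivial if $x\star y=1$ for all $x,y$. The Lie exterior square $K\wedge^L K$ of a multiplicative Lie algebra $(K,\cdot,\star)$ is the multiplicative Lie algebra, with Lie product denoted $\tilde\star$, generated by the formal symbols $a\wedge b$ and $[a,b]_0$ ($a,b\in K$) subject to the following relations, for all $a,b,c,u,v\in K$, where $[x,y]=xyx^{-1}y^{-1}$: 1. $1\wedge a=a\wedge 1=a\wedge a=[1,a]_0=[a,1]_0=[a,a]_0=1$; 2. $(a\wedge b)(b\wedge a)=1=[a,b]_0[b,a]_0$; 3. $(a\wedge bc)^{-1}(a\wedge b)({}^ba\wedge{}^bc)=1=[a,bc]_0^{-1}[a,b]_0[{}^ba,{}^bc]_0$; 4. $(ab\wedge c)^{-1}({}^ab\wedge{}^ac)(a\wedge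 c)=1=[ab,c]_0^{-1}[{}^ab,{}^ac]_0[a,c]_0$; 5. $[a\wedge b,u\wedge v]=[[a,b]_0,u\wedge v]=[a,b]_0\,\tilde\star\,(u\wedge v)=[a,b]_0\,\tilde\star\,[u,v]_0$; 6. $(a\wedge b)({}^cb\wedge{}^ca)=({}^{ab}(a^{-1})\wedge{}^ac)(a\wedge c)$; 7. $[a,b]_0[{}^cb,{}^ca]_0=[{}^{ab}(a^{-1}),{}^ac]_0[a,c]_0$; 8. $[[a,b]_0,[u,v]_0]=[[a,b],[u,v]]_0$; 9. $(a\wedge b)\,\tilde\star\,(u\wedge v)=(a\star b)\wedge(u\star v)$. **Proposition.** Let $n\ge 1$ be odd, let $D_n=\langle a,b\mid a^2=b^n=1,\ aba=b^{-1}\rangle$ be the dihedral group of order $2n$, let $1\le i\le n$, and let $\star$ be a multiplicative Lie algebra structure on the group $D_n$ with $a\star b=b^i$. Then $D_n\wedge^L D_n$ is isomorphic, as a group, to $\mathbb Z_n\times\mathbb Z_n$, and its Lie product is trivial: $x\,\tilde\star\,y=1$ for all $x,y\in D_n\wedge^L D_n$. -/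

import Mathlib

/-- A type with a binary operation `x ⋆ y` (the Lie product). -/
class LieProduct (K : Type*) where
  lieProd : K → K → K

infixl:72 " ⋆ " => LieProduct.lieProd

/-- Left conjugation `ˣy = x y x⁻¹`. -/
abbrev leftConj {K : Type*} [Mul K] [Inv K] (x y : K) : K := x * y * x⁻¹

/-- The commutator `[x, y] = x y x⁻¹ y⁻¹`. -/
abbrev groupComm {K : Type*} [Mul K] [Inv K] (x y : K) : K := x * y * x⁻¹ * y⁻¹

/-- A multiplicative Lie algebra structure on the (possibly non-abelian) group `K`. -/
class MultiplicativeLieAlgebra (K : Type*) [Group K] extends LieProduct K where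
  star_self' : ∀ x : K, x ⋆ x = 1
  star_mul' : ∀ x y z : K, x ⋆ (y * z) = (x ⋆ y) * leftConj y (x ⋆ z)
  mul_star' : ∀ x y z : K, (x * y) ⋆ z = leftConj x (y ⋆ z) * (x ⋆ z)
  jacobi' : ∀ x y z : K,
    ((x ⋆ y) ⋆ leftConj y z) * ((y ⋆ z) ⋆ leftConj z x) * ((z ⋆ x) ⋆ leftConj x y) = 1
  conj_star' : ∀ x y z : K, leftConj z (x ⋆ y) = leftConj z x ⋆ leftConj z y

/-! ### Multiplicative Lie algebras given by generators and relations -/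

/-- Formal words in the generators `X` and the operations of a multiplicative Lie algebra. -/
inductive MLWord (X : Type*) where
  | gen : X → MLWord X
  | one : MLWord X
  | mul : MLWord X → MLWord X → MLWord X
  | inv : MLWord X → MLWord X
  | star : MLWord X → MLWord X → MLWord X

namespace MLWord

variable {X : Type*}

instance : One (MLWord X) := ⟨MLWord.one⟩
instance : Mul (MLWord X) := ⟨MLWord.mul⟩
instance : Inv (MLWord X) := ⟨MLWord.inv⟩
instance : LieProduct (MLWord X) := ⟨MLWord.star⟩

/-- The least congruence on words that contains the relations `R` and whose quotient is a
multiplicative Lie algebra. -/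
inductive Congr (R : MLWord X → MLWord X → Prop) : MLWord X → MLWord X → Prop
  | of_rel {x y} : R x y → Congr R x y
  | refl (x) : Congr R x x
  | symm {x y} : Congr R x y → Congr R y x
  | trans {x y z} : Congr R x y → Congr R y z → Congr R x z
  | mul_congr {x x' y y'} : Congr R x x' → Congr R y y' → Congr R (x * y) (x' * y')
  | inv_congr {x x'} : Congr R x x' → Congr R x⁻¹ x'⁻¹
  | star_congr {x x' y y'} : Congr R x x' → Congr R y y' → Congr R (x ⋆ y) (x' ⋆ y')
  | mul_assoc (x y z) : Congr R (x * y * z) (x * (y * z))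
  | one_mul (x) : Congr R (1 * x) x
  | inv_mul_cancel (x) : Congr R (x⁻¹ * x) 1
  | star_self (x) : Congr R (x ⋆ x) 1
  | star_mul (x y z) : Congr R (x ⋆ (y * z)) ((x ⋆ y) * leftConj y (x ⋆ z))
  | mul_star (x y z) : Congr R ((x * y) ⋆ z) (leftConj x (y ⋆ z) * (x ⋆ z))
  | jacobi (x y z) : Congr R
      (((x ⋆ y) ⋆ leftConj y z) * ((y ⋆ z) ⋆ leftConj z x) * ((z ⋆ x) ⋆ leftConj x y)) 1
  | conj_star (x y z) : Congr R (leftConj z (x ⋆ y)) (leftConj z x ⋆ leftConj z y)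

/-- The congruence as a setoid. -/
def congrSetoid (R : MLWord X → MLWord X → Prop) : Setoid (MLWord X) :=
  ⟨Congr R, Congr.refl, Congr.symm, Congr.trans⟩

end MLWord

/-- The multiplicative Lie algebra with generators `X` and relations `R`. -/
def PresentedMLA {X : Type*} (R : MLWord X → MLWord X → Prop) : Type _ :=
  Quotient (MLWord.congrSetoid R)

namespace PresentedMLA

variable {X : Type*} (R : MLWord X → MLWord X → Prop)

instance : One (PresentedMLA R) := ⟨Quotient.mk (MLWord.congrSetoid R) 1⟩

instance : Mul (PresentedMLA R) :=
  ⟨Quotient.map₂ (· * ·) fun _ _ h _ _ h' => MLWord.Congr.mul_congr h h'⟩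

instance : Inv (PresentedMLA R) :=
  ⟨Quotient.map (·⁻¹) fun _ _ h => MLWord.Congr.inv_congr h⟩

instance : LieProduct (PresentedMLA R) :=
  ⟨Quotient.map₂ (· ⋆ ·) fun _ _ h _ _ h' => MLWord.Congr.star_congr h h'⟩

instance : Group (PresentedMLA R) :=
  Group.ofLeftAxioms
    (by rintro ⟨x⟩ ⟨y⟩ ⟨z⟩; exact Quotient.sound (MLWord.Congr.mul_assoc x y z))
    (by rintro ⟨x⟩; exact Quotient.sound (MLWord.Congr.one_mul x))
    (by rintro ⟨x⟩; exact Quotient.sound (MLWord.Congr.inv_mul_cancel x))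

instance : MultiplicativeLieAlgebra (PresentedMLA R) where
  star_self' := by rintro ⟨x⟩; exact Quotient.sound (MLWord.Congr.star_self x)
  star_mul' := by
    rintro ⟨x⟩ ⟨y⟩ ⟨z⟩; exact Quotient.sound (MLWord.Congr.star_mul x y z)
  mul_star' := by
    rintro ⟨x⟩ ⟨y⟩ ⟨z⟩; exact Quotient.sound (MLWord.Congr.mul_star x y z)
  jacobi' := by
    rintro ⟨x⟩ ⟨y⟩ ⟨z⟩; exact Quotient.sound (MLWord.Congr.jacobi x y z)
  conj_star' := by
    rintro ⟨x⟩ ⟨y⟩ ⟨z⟩; exact Quotient.sound (MLWord.Congr.conj_star x y z)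

end PresentedMLA

/-! ### The Lie exterior square -/

/-- The formal symbols `a ∧ b` and `[a, b]₀` for `a, b ∈ K`. -/
inductive ExtGen (K : Type*) where
  | wedge : K → K → ExtGen K
  | bracket : K → K → ExtGen K

/-- The word `a ∧ b`. -/
abbrev wdg {K : Type*} (a b : K) : MLWord (ExtGen K) := .gen (.wedge a b)

/-- The word `[a, b]₀`. -/
abbrev brk {K : Type*} (a b : K) : MLWord (ExtGen K) := .gen (.bracket a b)

/-- The defining relations of the Lie exterior square. -/
inductive LieExtRel (K : Type*) [Group K] [MultiplicativeLieAlgebra K] :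
    MLWord (ExtGen K) → MLWord (ExtGen K) → Prop
  | one_wedge (a : K) : LieExtRel K (wdg 1 a) 1
  | wedge_one (a : K) : LieExtRel K (wdg a 1) 1
  | wedge_self (a : K) : LieExtRel K (wdg a a) 1
  | one_bracket (a : K) : LieExtRel K (brk 1 a) 1
  | bracket_one (a : K) : LieExtRel K (brk a 1) 1
  | bracket_self (a : K) : LieExtRel K (brk a a) 1
  | wedge_swap (a b : K) : LieExtRel K (wdg a b * wdg b a) 1
  | bracket_swap (a b : K) : LieExtRel K (brk a b * brk b a) 1
  | wedge_mul (a b c : K) :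
      LieExtRel K ((wdg a (b * c))⁻¹ * wdg a b * wdg (leftConj b a) (leftConj b c)) 1
  | bracket_mul (a b c : K) :
      LieExtRel K ((brk a (b * c))⁻¹ * brk a b * brk (leftConj b a) (leftConj b c)) 1
  | mul_wedge (a b c : K) :
      LieExtRel K ((wdg (a * b) c)⁻¹ * wdg (leftConj a b) (leftConj a c) * wdg a c) 1
  | mul_bracket (a b c : K) :
      LieExtRel K ((brk (a * b) c)⁻¹ * brk (leftConj a b) (leftConj a c) * brk a c) 1
  | comm_wedge_wedge (a b u v : K) :
      LieExtRel K (groupComm (wdg a b) (wdg u v)) (groupComm (brk a b) (wdg u v))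
  | comm_bracket_wedge (a b u v : K) :
      LieExtRel K (groupComm (brk a b) (wdg u v)) (brk a b ⋆ wdg u v)
  | star_bracket_wedge (a b u v : K) :
      LieExtRel K (brk a b ⋆ wdg u v) (brk a b ⋆ brk u v)
  | wedge_comm (a b c : K) :
      LieExtRel K (wdg a b * wdg (leftConj c b) (leftConj c a))
        (wdg (leftConj (a * b) a⁻¹) (leftConj a c) * wdg a c)
  | bracket_comm (a b c : K) :
      LieExtRel K (brk a b * brk (leftConj c b) (leftConj c a))
        (brk (leftConj (a * b) a⁻¹) (leftConj a c) * brk a c)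
  | comm_bracket_bracket (a b u v : K) :
      LieExtRel K (groupComm (brk a b) (brk u v)) (brk (groupComm a b) (groupComm u v))
  | star_wedge_wedge (a b u v : K) :
      LieExtRel K (wdg a b ⋆ wdg u v) (wdg (a ⋆ b) (u ⋆ v))

/-- The Lie exterior square `K ∧ᴸ K`. -/
abbrev LieExteriorSquare (K : Type*) [Group K] [MultiplicativeLieAlgebra K] : Type _ :=
  PresentedMLA (LieExtRel K)

/-! Each of a ∧ b and [a, b]₀ is an exterior pairing on Dₙ, and every such pairing factors through
one explicit map `pairing` into the abelian group ℤₙ (`IsExteriorPairing.hom_pairing`). So wedges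
commute with each other, and relation 5 then kills the commutators and Lie products of brackets with
wedges and the Lie products of brackets. A product of two wedges is (a ⋆ b) ∧ (u ⋆ v); since a ⋆ b =
bⁱ, all values of ⋆ are rotations, on which every exterior pairing vanishes. Hence the Lie product
is trivial, the symbols generate the square as a group, and it is a quotient of ℤₙ × ℤₙ. Conversely,
ℤₙ × ℤₙ with trivial Lie product satisfies all the relations, which gives the inverse map. -/

namespace MultiplicativeLieAlgebra

/-! ### Antisymmetry of ⋆ and passage from generators to subgroups -/

section Basic

variable {K : Type*} [Group K] [MultiplicativeLieAlgebra K]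

theorem star_one (x : K) : x ⋆ (1 : K) = 1 := by
  have h := star_mul' x 1 1
  simpa [leftConj] using h

/-- Expand (xy) ⋆ (xy) = 1 in both variables: the diagonal terms vanish and a conjugate of the
product remains. -/
theorem star_swap_mul (x y : K) : (y ⋆ x) * (x ⋆ y) = 1 := by
  have h := star_self' (x * y)
  rw [mul_star', star_mul' y x y, star_mul' x x y, star_self', star_self'] at h
  simp only [leftConj, one_mul, mul_one, mul_inv_cancel] at h
  have h' : x * ((y ⋆ x) * (x ⋆ y)) * x⁻¹ = 1 := by
    rw [← h]; group
  exact conj_eq_one_iff.mp h'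

theorem star_swap (x y : K) : y ⋆ x = (x ⋆ y)⁻¹ :=
  eq_inv_of_mul_eq_one_left (star_swap_mul x y)

/-- The elements `y` with `x ⋆ y` in a given normal subgroup. -/
def starPreimage (N : Subgroup K) [hN : N.Normal] (x : K) : Subgroup K where
  carrier := {y | x ⋆ y ∈ N}
  one_mem' := by
    change x ⋆ (1 : K) ∈ N
    rw [star_one]
    exact N.one_mem
  mul_mem' := by
    intro y z hy hz
    change x ⋆ (y * z) ∈ N
    rw [star_mul']
    exact N.mul_mem hy (hN.conj_mem _ hz y)
  inv_mem' := by
    intro y hy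
    change x ⋆ y⁻¹ ∈ N
    have h := star_mul' x y⁻¹ y
    rw [inv_mul_cancel, star_one] at h
    rw [eq_inv_of_mul_eq_one_left h.symm]
    exact N.inv_mem (hN.conj_mem _ hy _)

/-- If all products of elements of `S` lie in the normal subgroup `N`, then so do all products
of elements of the subgroup generated by `S`. -/
theorem star_mem_of_mem_closure {N : Subgroup K} [N.Normal] {S : Set K}
    (h : ∀ x ∈ S, ∀ y ∈ S, x ⋆ y ∈ N) {x y : K} (hx : x ∈ Subgroup.closure S)
    (hy : y ∈ Subgroup.closure S) : x ⋆ y ∈ N := by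
  have h₁ : ∀ x ∈ S, ∀ y ∈ Subgroup.closure S, x ⋆ y ∈ N := fun x hx y hy =>
    ((Subgroup.closure_le (starPreimage N x)).mpr fun z hz => h x hx z hz) hy
  -- `starPreimage` controls only the right-hand variable; antisymmetry transfers this to the left
  -- one.
  have h₂ : x ∈ starPreimage N y :=
    ((Subgroup.closure_le (starPreimage N y)).mpr fun z hz => by
      change y ⋆ z ∈ N
      rw [star_swap z y]
      exact N.inv_mem (h₁ z hz y hy)) hx
  rw [star_swap y x]
  exact N.inv_mem h₂

end Basic

/-- An abelian group with the trivial Lie product. -/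
@[reducible]
def trivialOfCommGroup (A : Type*) [CommGroup A] : MultiplicativeLieAlgebra A where
  lieProd _ _ := 1
  star_self' _ := rfl
  star_mul' _ _ _ := by simp [leftConj]
  mul_star' _ _ _ := by simp [leftConj]
  jacobi' _ _ _ := by simp
  conj_star' _ _ _ := by simp [leftConj]

end MultiplicativeLieAlgebra

/-! ### Evaluation of words and maps out of a presentation -/

namespace MLWord

variable {X L : Type*} [Group L] [MultiplicativeLieAlgebra L]

/-- The value of a word under an assignment of the generators. -/
def eval (f : X → L) : MLWord X → L
  | gen x => f x
  | one => 1
  | mul x y => eval f x * eval f y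
  | inv x => (eval f x)⁻¹
  | star x y => eval f x ⋆ eval f y

variable (f : X → L)

@[simp] theorem eval_gen (x : X) : eval f (gen x) = f x := rfl

@[simp] theorem eval_one : eval f 1 = 1 := rfl

@[simp] theorem eval_mul (x y : MLWord X) : eval f (x * y) = eval f x * eval f y := rfl

@[simp] theorem eval_inv (x : MLWord X) : eval f x⁻¹ = (eval f x)⁻¹ := rfl

@[simp] theorem eval_star (x y : MLWord X) : eval f (x ⋆ y) = eval f x ⋆ eval f y := rfl

theorem Congr.eval_eq {f : X → L} {R : MLWord X → MLWord X → Prop}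
    (hf : ∀ x y, R x y → eval f x = eval f y) {x y : MLWord X} (h : Congr R x y) :
    eval f x = eval f y := by
  induction h with
  | of_rel h => exact hf _ _ h
  | refl => rfl
  | symm _ ih => exact ih.symm
  | trans _ _ ih ih' => exact ih.trans ih'
  | mul_congr _ _ ih ih' => simp [ih, ih']
  | inv_congr _ ih => simp [ih]
  | star_congr _ _ ih ih' => simp [ih, ih']
  | mul_assoc => simp [_root_.mul_assoc]
  | one_mul => simp
  | inv_mul_cancel => simp
  | star_self => exact MultiplicativeLieAlgebra.star_self' _
  | star_mul => exact MultiplicativeLieAlgebra.star_mul' _ _ _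
  | mul_star => exact MultiplicativeLieAlgebra.mul_star' _ _ _
  | jacobi => exact MultiplicativeLieAlgebra.jacobi' _ _ _
  | conj_star => exact MultiplicativeLieAlgebra.conj_star' _ _ _

end MLWord

namespace PresentedMLA

variable {X : Type*} {R : MLWord X → MLWord X → Prop}

/-- The class of a word. -/
def mk (R : MLWord X → MLWord X → Prop) (x : MLWord X) : PresentedMLA R :=
  Quotient.mk (MLWord.congrSetoid R) x

/-- The class of a generator. -/
def of (R : MLWord X → MLWord X → Prop) (x : X) : PresentedMLA R := mk R (.gen x)

theorem mk_eq_of_rel {x y : MLWord X} (h : R x y) : mk R x = mk R y :=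
  Quotient.sound (MLWord.Congr.of_rel h)

/-- If the products of generators are trivial, then the generators generate the presented
multiplicative Lie algebra as a group. -/
theorem closure_range_of (h : ∀ x y, of R x ⋆ of R y = 1) :
    Subgroup.closure (Set.range (of R)) = ⊤ := by
  rw [eq_top_iff]
  rintro ⟨x⟩ -
  change mk R x ∈ _
  induction x with
  | gen x => exact Subgroup.subset_closure ⟨x, rfl⟩
  | one => exact Subgroup.one_mem _
  | mul x y ihx ihy => exact Subgroup.mul_mem _ ihx ihy
  | inv x ihx => exact Subgroup.inv_mem _ ihx
  | star x y ihx ihy =>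
    -- Taking N = ⊥ shows that a Lie product of elements of the group closure is 1.
    have : mk R x ⋆ mk R y ∈ (⊥ : Subgroup (PresentedMLA R)) := by
      refine MultiplicativeLieAlgebra.star_mem_of_mem_closure ?_ ihx ihy
      rintro _ ⟨x, rfl⟩ _ ⟨y, rfl⟩
      exact h x y
    change mk R x ⋆ mk R y ∈ _
    rw [Subgroup.mem_bot.mp this]
    exact Subgroup.one_mem _

theorem star_eq_one (h : ∀ x y, of R x ⋆ of R y = 1) (x y : PresentedMLA R) : x ⋆ y = 1 := by
  have hx : ∀ x, x ∈ Subgroup.closure (Set.range (of R)) := fun x => by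
    rw [closure_range_of h]; trivial
  refine Subgroup.mem_bot.mp (MultiplicativeLieAlgebra.star_mem_of_mem_closure ?_ (hx x) (hx y))
  rintro _ ⟨x, rfl⟩ _ ⟨y, rfl⟩
  exact h x y

/-- The group homomorphism induced by an assignment of the generators that respects the
relations. -/
def lift {L : Type*} [Group L] [MultiplicativeLieAlgebra L] (f : X → L)
    (hf : ∀ x y, R x y → MLWord.eval f x = MLWord.eval f y) : PresentedMLA R →* L where
  toFun := Quotient.lift (MLWord.eval f) fun _ _ h => MLWord.Congr.eval_eq hf h
  map_one' := rfl
  map_mul' := by rintro ⟨x⟩ ⟨y⟩; rfl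

end PresentedMLA

/-! ### Exterior pairings on dihedral groups -/

/-- The relations of the non-abelian exterior square that are shared by `a ∧ b` and `[a, b]₀`. -/
structure IsExteriorPairing {K G : Type*} [Group K] [Group G] (w : K → K → G) : Prop where
  self : ∀ a, w a a = 1
  swap : ∀ a b, w b a = (w a b)⁻¹
  map_mul_right : ∀ a b c, w a (b * c) = w a b * w (leftConj b a) (leftConj b c)
  map_mul_left : ∀ a b c, w (a * b) c = w (leftConj a b) (leftConj a c) * w a c

namespace DihedralGroup

variable {n : ℕ}

theorem eq_sr_zero_mul_r (j : ZMod n) : (sr j : DihedralGroup n) = sr 0 * r j := by simp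

theorem mem_of_r_one_mem {H : Subgroup (DihedralGroup n)} (h : r 1 ∈ H) (k : ZMod n) :
    r k ∈ H := by
  obtain ⟨m, rfl⟩ := ZMod.intCast_surjective k
  rw [← r_one_zpow]
  exact H.zpow_mem h m

theorem closure_sr_zero_r_one :
    Subgroup.closure ({sr 0, r 1} : Set (DihedralGroup n)) = ⊤ := by
  rw [eq_top_iff]
  have hr := mem_of_r_one_mem (n := n)
    (Subgroup.subset_closure (show r 1 ∈ ({sr 0, r 1} : Set (DihedralGroup n)) by simp))
  rintro (k | k) -
  · exact hr k
  · rw [eq_sr_zero_mul_r k]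
    exact Subgroup.mul_mem _ (Subgroup.subset_closure (Set.mem_insert _ _)) (hr k)

/-- The subgroup of rotations. -/
def rotations (n : ℕ) : Subgroup (DihedralGroup n) where
  carrier := Set.range r
  one_mem' := ⟨0, rfl⟩
  mul_mem' := by rintro _ _ ⟨i, rfl⟩ ⟨j, rfl⟩; exact ⟨i + j, by simp⟩
  inv_mem' := by rintro _ ⟨i, rfl⟩; exact ⟨-i, by simp⟩

theorem mem_rotations {x : DihedralGroup n} : x ∈ rotations n ↔ ∃ k, r k = x := Iff.rfl

instance : (rotations n).Normal where
  conj_mem := by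
    rintro _ ⟨i, rfl⟩ (j | j)
    · exact ⟨i, by simp⟩
    · exact ⟨-i, by simp⟩

/-- If `a ⋆ b` is a rotation, then all values of the Lie product are rotations. -/
theorem star_mem_rotations [MultiplicativeLieAlgebra (DihedralGroup n)]
    (h : (sr 0 : DihedralGroup n) ⋆ r 1 ∈ rotations n) (x y : DihedralGroup n) :
    x ⋆ y ∈ rotations n := by
  have htop : ∀ x, x ∈ Subgroup.closure ({sr 0, r 1} : Set (DihedralGroup n)) := fun x => by
    rw [closure_sr_zero_r_one]; trivial
  refine MultiplicativeLieAlgebra.star_mem_of_mem_closure ?_ (htop x) (htop y)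
  rintro x (rfl | rfl) y (rfl | rfl)
  · rw [MultiplicativeLieAlgebra.star_self']; exact Subgroup.one_mem _
  · exact h
  · rw [MultiplicativeLieAlgebra.star_swap (sr 0)]; exact Subgroup.inv_mem _ h
  · rw [MultiplicativeLieAlgebra.star_self']; exact Subgroup.one_mem _

/-- The universal exterior pairing on the dihedral group. -/
def pairing : DihedralGroup n → DihedralGroup n → ZMod n
  | r _, r _ => 0
  | r i, sr _ => i
  | sr _, r j => -j
  | sr i, sr j => j - i

theorem pairing_mul_right (a b c : DihedralGroup n) :
    pairing a (b * c) = pairing a b + pairing (leftConj b a) (leftConj b c) := by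
  rcases a with i | i <;> rcases b with j | j <;> rcases c with k | k <;>
    simp [pairing, leftConj] <;> ring

theorem pairing_mul_left (a b c : DihedralGroup n) :
    pairing (a * b) c = pairing (leftConj a b) (leftConj a c) + pairing a c := by
  rcases a with i | i <;> rcases b with j | j <;> rcases c with k | k <;>
    simp [pairing, leftConj] <;> ring

theorem isExteriorPairing_pairing :
    IsExteriorPairing fun a b : DihedralGroup n => Multiplicative.ofAdd (pairing a b) where
  self := by rintro (i | i) <;> simp [pairing]
  swap := by rintro (i | i) (j | j) <;> simp [pairing, ← ofAdd_neg]
  map_mul_right a b c := congrArg Multiplicative.ofAdd (pairing_mul_right a b c)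
  map_mul_left a b c := congrArg Multiplicative.ofAdd (pairing_mul_left a b c)

theorem pairing_eq_zero_of_mem_rotations {x y : DihedralGroup n} (hx : x ∈ rotations n)
    (hy : y ∈ rotations n) : pairing x y = 0 := by
  obtain ⟨i, rfl⟩ := hx
  obtain ⟨j, rfl⟩ := hy
  rfl

/-- Additive form of relations 6 and 7, needed only for the map into ℤₙ × ℤₙ. -/
theorem pairing_add_pairing_conj (a b c : DihedralGroup n) :
    pairing a b + pairing (leftConj c b) (leftConj c a) =
      pairing (leftConj (a * b) a⁻¹) (leftConj a c) + pairing a c := by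
  rcases a with i | i <;> rcases b with j | j <;> rcases c with k | k <;>
    simp [pairing, leftConj] <;> ring

theorem groupComm_mem_rotations (x y : DihedralGroup n) : groupComm x y ∈ rotations n := by
  rcases x with i | i <;> rcases y with j | j <;> simp [groupComm, mem_rotations]

end DihedralGroup

namespace IsExteriorPairing

open DihedralGroup

variable {n : ℕ} {G : Type*} [Group G] {w : DihedralGroup n → DihedralGroup n → G}

/-- Rotations commute, so `w` is bimultiplicative on them; they form a cyclic group and `w (r 1) (r
1) = 1`. -/
theorem r_r (hw : IsExteriorPairing w) (i j : ZMod n) : w (r i) (r j) = 1 := by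
  have hr : ∀ i j k, w (r i) (r (j + k)) = w (r i) (r j) * w (r i) (r k) := fun i j k => by
    simpa [leftConj] using hw.map_mul_right (r i) (r j) (r k)
  have key : ∀ i, w (r i) (r 1) = 1 → ∀ j, w (r i) (r j) = 1 := fun i h j => by
    obtain ⟨m, rfl⟩ := ZMod.intCast_surjective j
    let f : Multiplicative (ZMod n) →* G :=
      MonoidHom.mk' (fun j => w (r i) (r j.toAdd)) fun j k => hr i _ _
    have h1 : f (Multiplicative.ofAdd 1) = 1 := h
    have h2 := map_zpow f (Multiplicative.ofAdd 1) m
    rw [h1, one_zpow, ← ofAdd_zsmul, zsmul_one] at h2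
    exact h2
  refine key i ?_ j
  rw [hw.swap (r 1), key 1 (hw.self _) i, inv_one]

theorem r_sr (hw : IsExteriorPairing w) (i j : ZMod n) : w (r i) (sr j) = w (r i) (sr 0) := by
  rw [eq_sr_zero_mul_r, hw.map_mul_right]
  simp [leftConj, hw.r_r]

/-- The homomorphism through which an exterior pairing factors. -/
def hom (hw : IsExteriorPairing w) : Multiplicative (ZMod n) →* G :=
  MonoidHom.mk' (fun i => w (r i.toAdd) (sr 0)) fun i j => by
    -- Taking `r j` first leaves the factor of `r i` on the left. Conjugation by `r j` moves `sr 0`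
    -- to another reflection, which `r_sr` ignores.
    have h := hw.map_mul_left (r j.toAdd) (r i.toAdd) (sr 0)
    rw [r_mul_r, add_comm] at h
    rw [toAdd_mul, h]
    simp only [leftConj, r_mul_r, r_mul_sr, inv_r, sr_mul_r]
    rw [hw.r_sr _ (_ + _), add_neg_cancel_comm]

theorem hom_ofAdd (hw : IsExteriorPairing w) (i : ZMod n) :
    hw.hom (Multiplicative.ofAdd i) = w (r i) (sr 0) := rfl

theorem hom_pairing (hw : IsExteriorPairing w) (x y : DihedralGroup n) :
    hw.hom (Multiplicative.ofAdd (pairing x y)) = w x y := by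
  have hsr : ∀ i j, w (sr i) (r j) = hw.hom (Multiplicative.ofAdd (-j)) := fun i j => by
    rw [hw.swap (r j), hw.r_sr, ofAdd_neg, map_inv, hom_ofAdd]
  rcases x with i | i <;> rcases y with j | j <;> simp only [pairing]
  · rw [hw.r_r, ofAdd_zero, map_one]
  · rw [hw.r_sr, hom_ofAdd]
  · rw [hsr]
  -- Writing `sr j = sr i * r (j - i)` makes the first factor `w (sr i) (sr i) = 1`.
  · have h := hw.map_mul_right (sr i) (sr i) (r (j - i))
    rw [hw.self, one_mul] at h
    rw [sr_mul_r, add_sub_cancel] at h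
    rw [h]
    simp only [leftConj, sr_mul_r, sr_mul_sr, inv_sr]
    rw [sub_self, r_zero, one_mul, hsr]
    congr 2
    abel

theorem commute (hw : IsExteriorPairing w) (x y z t : DihedralGroup n) :
    Commute (w x y) (w z t) := by
  rw [← hw.hom_pairing x y, ← hw.hom_pairing z t]
  exact (Commute.all _ _).map hw.hom

end IsExteriorPairing

/-! ### The Lie exterior square and its identification for Dₙ -/

namespace LieExteriorSquare

open PresentedMLA

section General

variable (K : Type*) [Group K] [MultiplicativeLieAlgebra K]

/-- The element `a ∧ b` of the Lie exterior square. -/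
def wedge (a b : K) : LieExteriorSquare K := of (LieExtRel K) (.wedge a b)

/-- The element `[a, b]₀` of the Lie exterior square. -/
def bracket (a b : K) : LieExteriorSquare K := of (LieExtRel K) (.bracket a b)

theorem isExteriorPairing_wedge : IsExteriorPairing (wedge K) where
  self a := mk_eq_of_rel (.wedge_self a)
  swap a b := eq_inv_of_mul_eq_one_right (mk_eq_of_rel (.wedge_swap a b))
  map_mul_right a b c := by
    have h : (wedge K a (b * c))⁻¹ * wedge K a b * wedge K (leftConj b a) (leftConj b c) = 1 :=
      mk_eq_of_rel (.wedge_mul a b c)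
    rwa [mul_assoc, inv_mul_eq_one] at h
  map_mul_left a b c := by
    have h : (wedge K (a * b) c)⁻¹ * wedge K (leftConj a b) (leftConj a c) * wedge K a c = 1 :=
      mk_eq_of_rel (.mul_wedge a b c)
    rwa [mul_assoc, inv_mul_eq_one] at h

theorem isExteriorPairing_bracket : IsExteriorPairing (bracket K) where
  self a := mk_eq_of_rel (.bracket_self a)
  swap a b := eq_inv_of_mul_eq_one_right (mk_eq_of_rel (.bracket_swap a b))
  map_mul_right a b c := by
    have h : (bracket K a (b * c))⁻¹ * bracket K a b *
        bracket K (leftConj b a) (leftConj b c) = 1 := mk_eq_of_rel (.bracket_mul a b c)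
    rwa [mul_assoc, inv_mul_eq_one] at h
  map_mul_left a b c := by
    have h : (bracket K (a * b) c)⁻¹ * bracket K (leftConj a b) (leftConj a c) *
        bracket K a c = 1 := mk_eq_of_rel (.mul_bracket a b c)
    rwa [mul_assoc, inv_mul_eq_one] at h

variable {K}

theorem groupComm_wedge_wedge (a b u v : K) : groupComm (wedge K a b) (wedge K u v) =
    groupComm (bracket K a b) (wedge K u v) := mk_eq_of_rel (.comm_wedge_wedge a b u v)

theorem groupComm_bracket_wedge (a b u v : K) : groupComm (bracket K a b) (wedge K u v) =
    bracket K a b ⋆ wedge K u v := mk_eq_of_rel (.comm_bracket_wedge a b u v)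

theorem bracket_star_wedge (a b u v : K) : bracket K a b ⋆ wedge K u v =
    bracket K a b ⋆ bracket K u v := mk_eq_of_rel (.star_bracket_wedge a b u v)

theorem wedge_star_wedge (a b u v : K) : wedge K a b ⋆ wedge K u v =
    wedge K (a ⋆ b) (u ⋆ v) := mk_eq_of_rel (.star_wedge_wedge a b u v)

end General

section Dihedral

open DihedralGroup

variable {n : ℕ} [MultiplicativeLieAlgebra (DihedralGroup n)]

/-- Relation 5 equates this with a commutator of two wedges, which commute. -/
theorem groupComm_bracket_wedge_eq_one (a b u v : DihedralGroup n) :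
    groupComm (bracket _ a b) (wedge _ u v) = 1 := by
  rw [← groupComm_wedge_wedge]
  exact commutatorElement_eq_one_iff_commute.mpr
    ((isExteriorPairing_wedge _).commute a b u v)

theorem commute_wedge_bracket (a b u v : DihedralGroup n) :
    Commute (wedge _ u v) (bracket _ a b) :=
  (commutatorElement_eq_one_iff_commute.mp (groupComm_bracket_wedge_eq_one a b u v)).symm

/-- Only the wedge–wedge case needs `h`; the others reduce to bracket–wedge commutators. -/
theorem of_star_of (h : ∀ x y : DihedralGroup n, x ⋆ y ∈ rotations n)
    (x y : ExtGen (DihedralGroup n)) :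
    of (LieExtRel _) x ⋆ of (LieExtRel _) y = 1 := by
  have hbw (a b u v : DihedralGroup n) : bracket _ a b ⋆ wedge _ u v = 1 := by
    rw [← groupComm_bracket_wedge, groupComm_bracket_wedge_eq_one]
  rcases x with ⟨a, b⟩ | ⟨a, b⟩ <;> rcases y with ⟨u, v⟩ | ⟨u, v⟩
  · refine (wedge_star_wedge a b u v).trans ?_
    rw [← (isExteriorPairing_wedge _).hom_pairing,
      pairing_eq_zero_of_mem_rotations (h a b) (h u v), ofAdd_zero, map_one]
  · refine (MultiplicativeLieAlgebra.star_swap (bracket _ u v) (wedge _ a b)).trans ?_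
    rw [hbw, inv_one]
  · exact hbw a b u v
  · exact (bracket_star_wedge a b u v).symm.trans (hbw a b u v)

/-- The images of the generators in `ℤₙ × ℤₙ`. -/
def genValue : ExtGen (DihedralGroup n) → Multiplicative (ZMod n) × Multiplicative (ZMod n)
  | .wedge a b => (Multiplicative.ofAdd (pairing a b), 1)
  | .bracket a b => (1, Multiplicative.ofAdd (pairing a b))

-- In relations 8 and 9 the pairing is taken between commutators, respectively Lie products. All of
-- these are rotations, so it vanishes.
attribute [local instance] MultiplicativeLieAlgebra.trivialOfCommGroup in
theorem eval_genValue (h : ∀ x y : DihedralGroup n, x ⋆ y ∈ rotations n)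
    (x y : MLWord (ExtGen (DihedralGroup n))) (hxy : LieExtRel _ x y) :
    MLWord.eval genValue x = MLWord.eval genValue y := by
  have hp := isExteriorPairing_pairing (n := n)
  have one_left (a : DihedralGroup n) : pairing 1 a = 0 := by cases a <;> rfl
  have one_right (a : DihedralGroup n) : pairing a 1 = 0 := by
    rw [one_def]
    cases a <;> simp [pairing]
  have self (a : DihedralGroup n) : pairing a a = 0 := hp.self a
  have swap (a b : DihedralGroup n) : pairing b a = -pairing a b := hp.swap a b
  have star (u v : Multiplicative (ZMod n) × Multiplicative (ZMod n)) : u ⋆ v = 1 := rfl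
  have rot {x y : DihedralGroup n} := pairing_eq_zero_of_mem_rotations (x := x) (y := y)
  cases hxy with
  | one_wedge a => simp [genValue, one_left]
  | wedge_one a => simp [genValue, one_right]
  | wedge_self a => simp [genValue, self]
  | one_bracket a => simp [genValue, one_left]
  | bracket_one a => simp [genValue, one_right]
  | bracket_self a => simp [genValue, self]
  | wedge_swap a b => simp [genValue, swap a b]
  | bracket_swap a b => simp [genValue, swap a b]
  | wedge_mul a b c => simp [genValue, pairing_mul_right a b c, mul_assoc]
  | bracket_mul a b c => simp [genValue, pairing_mul_right a b c, mul_assoc]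
  | mul_wedge a b c => simp [genValue, pairing_mul_left a b c, mul_assoc]
  | mul_bracket a b c => simp [genValue, pairing_mul_left a b c, mul_assoc]
  | comm_wedge_wedge a b u v => simp [genValue]
  | comm_bracket_wedge a b u v => simp [genValue, star]
  | star_bracket_wedge a b u v => simp [star]
  | wedge_comm a b c => simp [genValue, ← ofAdd_add, pairing_add_pairing_conj a b c]
  | bracket_comm a b c => simp [genValue, ← ofAdd_add, pairing_add_pairing_conj a b c]
  | comm_bracket_bracket a b u v =>
    have h₀ := rot (groupComm_mem_rotations a b) (groupComm_mem_rotations u v)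
    simp [genValue, h₀]
  | star_wedge_wedge a b u v => simp [genValue, star, rot (h a b) (h u v), Prod.one_eq_mk]

/-- The homomorphism `ℤₙ × ℤₙ → Dₙ ∧ᴸ Dₙ`. -/
def fromProd (n : ℕ) [MultiplicativeLieAlgebra (DihedralGroup n)] :
    Multiplicative (ZMod n) × Multiplicative (ZMod n) →*
      LieExteriorSquare (DihedralGroup n) :=
  (isExteriorPairing_wedge (DihedralGroup n)).hom.noncommCoprod
    (isExteriorPairing_bracket (DihedralGroup n)).hom fun _ _ => commute_wedge_bracket _ _ _ _

theorem fromProd_genValue (x : ExtGen (DihedralGroup n)) :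
    fromProd n (genValue x) = of (LieExtRel _) x := by
  rcases x with ⟨a, b⟩ | ⟨a, b⟩
  · refine (MonoidHom.noncommCoprod_apply _ _ _ _).trans ?_
    rw [genValue, map_one, mul_one]
    exact (isExteriorPairing_wedge _).hom_pairing a b
  · refine (MonoidHom.noncommCoprod_apply _ _ _ _).trans ?_
    rw [genValue, map_one, one_mul]
    exact (isExteriorPairing_bracket _).hom_pairing a b

attribute [local instance] MultiplicativeLieAlgebra.trivialOfCommGroup in
/-- The homomorphism `Dₙ ∧ᴸ Dₙ → ℤₙ × ℤₙ`. -/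
def toProd (h : ∀ x y : DihedralGroup n, x ⋆ y ∈ rotations n) :
    LieExteriorSquare (DihedralGroup n) →*
      Multiplicative (ZMod n) × Multiplicative (ZMod n) :=
  lift genValue (eval_genValue h)

/-- The Lie exterior square of a dihedral group is `ℤₙ × ℤₙ`. -/
def equivProd (h : ∀ x y : DihedralGroup n, x ⋆ y ∈ rotations n) :
    LieExteriorSquare (DihedralGroup n) ≃*
      Multiplicative (ZMod n) × Multiplicative (ZMod n) :=
  (toProd h).toMulEquiv (fromProd n)
    (MonoidHom.eq_of_eqOn_dense (closure_range_of (of_star_of h)) (by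
      rintro _ ⟨x, rfl⟩
      exact fromProd_genValue x))
    (MonoidHom.ext fun ⟨i, j⟩ => by
      -- `pairing (r i) (sr 0)` is `i`, so the two factors give the two coordinates.
      change toProd h (wedge _ (r i.toAdd) (sr 0) * bracket _ (r j.toAdd) (sr 0)) = _
      rw [map_mul]
      exact Prod.ext (mul_one i) (one_mul j))

end Dihedral

end LieExteriorSquare
theorem mainTheorem9 (n : ℕ) (hn : Odd n)
    [MultiplicativeLieAlgebra (DihedralGroup n)] (i : ℕ) (hi : 1 ≤ i) (hin : i ≤ n)
    (hstar : (DihedralGroup.sr 0 : DihedralGroup n) ⋆ DihedralGroup.r 1 =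
      DihedralGroup.r 1 ^ i) :
    Nonempty (LieExteriorSquare (DihedralGroup n) ≃* Multiplicative (ZMod n × ZMod n)) ∧
      ∀ x y : LieExteriorSquare (DihedralGroup n), x ⋆ y = 1 := by
  have h := DihedralGroup.star_mem_rotations (n := n) (by rw [hstar]; exact Subgroup.pow_mem _ (DihedralGroup.mem_rotations.mpr ⟨1, rfl⟩) i)
  exact ⟨⟨(LieExteriorSquare.equivProd h).trans (MulEquiv.prodMultiplicative _ _).symm⟩,
    PresentedMLA.star_eq_one (LieExteriorSquare.of_star_of h)⟩
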